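/- For a positive integer $n$ let $H(n)$ be the sum of the squares of the decimal digits of $n$, and call $n$ a $(2,10)$-happy number if $H^k(n)=1$ for some $k\ge 0$. Let $A$ be the set of $(2,10)$-happy numbers, and let $$\underline{d}=\liminf_{n\to\infty}\frac{|A\cap\{1,\dots,n\}|}{n},\qquad \bar{d}=\limsup_{n\to\infty}\frac{|A\cap\{1,\dots,n\}|}{n}$$ be its lower and upper density. Then $$\underline{d}<0.1138\qquad\text{and}\qquad \bar{d}>0.18577.$$ In particular, the asymptotic density $\lim_{n\to\infty}|A\cap\{1,\dots,n\}|/n$ of the $(2,10)$-happy numbers does not exist. -/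

import Mathlib

open Filter Topology

/-- The `(e, b)`-happy function: the sum of the `e`-th powers of the base-`b` digits of `n`. -/
def happyMap (e b n : ℕ) : ℕ :=
  ((Nat.digits b n).map (fun a => a ^ e)).sum

/-- A positive integer `n` is `(e, b)`-happy if iterating the `(e, b)`-happy function from `n`
eventually arrives at `1`. -/
def IsHappy (e b n : ℕ) : Prop :=
  0 < n ∧ ∃ k : ℕ, (happyMap e b)^[k] n = 1

/-- The proportion of the integers `1, …, n` that lie in `A`
(with value `0` at `n = 0`, which is irrelevant for the limits below). -/
noncomputable def relDensity (A : Set ℕ) (n : ℕ) : ℝ :=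
  ((A ∩ Set.Icc 1 n).ncard : ℝ) / (n : ℝ)

/-- The upper (asymptotic) density of `A`. The sequence `relDensity A` takes values in `[0, 1]`,
so this is a genuine limit superior. -/
noncomputable def upperDensity (A : Set ℕ) : ℝ :=
  limsup (relDensity A) atTop

/-- The lower (asymptotic) density of `A`. -/
noncomputable def lowerDensity (A : Set ℕ) : ℝ :=
  liminf (relDensity A) atTop

/-- `A` has asymptotic density `d`. -/
def HasAsymptoticDensity (A : Set ℕ) (d : ℝ) : Prop :=
  Tendsto (relDensity A) atTop (𝓝 d)

/-!
For an invariant set `B` of the happy function `H`, let `f m` be the proportion of `B` in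
`[0, 10 ^ m)`, which is the probability that `H n` lies in `B` for a random `m`-digit number `n`
(leading zeros allowed). Since `H n` is then a sum of `m` independent squares of random digits, the
sum of `f m` over `m < M` counts the expected visits to `B` of the first `M` positions of a random
walk with mean step `57 / 2`. By the renewal theorem this walk visits every place `h` far from `0`
with nearly the same expected frequency `2 / 57`, so the average of `f m` over `m < M` is about the
proportion of `B` below `57 / 2 * M`. Taking `57 / 2 * M` about `10 ^ k`, some `m` much larger than
`k` has `f m ≤ f k + 100 / 10 ^ (k / 8)` (`exists_digitDensity_le`). Iterating this from a
`k ≥ 400`, the errors add up to almost nothing, so `f m` is at most about `f k` for infinitely many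
`m` (`frequently_digitDensity_le`). Applied to the happy numbers and to their complement, any value
`f k` with `k ≥ 400` bounds the lower density from above and the upper density from below, up to a
tiny error.

The rate in the renewal theorem (`renewal_le`) comes from a crude contraction: the renewal function
is eventually the average of its values at nine earlier places at distance at most `81`, one of them
at distance `1`, so its oscillation over windows of length `81` shrinks by the factor `1 - 9⁻⁸¹`
from each window to the next. That is enough because `10 ^ 400` is far larger than `9 ^ 81`.

It remains to compute that the proportion of happy numbers is at least `0.185773` in
`[0, 10 ^ 404)` and that the proportion of the other numbers is at least `0.886239` in
`[0, 10 ^ 2368)` (`happy_digitDensity_404`, `unhappy_digitDensity_2368`). The distribution of `H`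
has the generating polynomial `(∑ d < 10, X ^ d²) ^ m`. Its powers are evaluated at `X = 2 ^ K`,
which packs the coefficients into one natural number, and the number is cut down after each squaring
to a window around the mean and to the leading bits of the coefficients. Cutting can only decrease
the coefficients, so lower bounds for the counts result (`PackedBound`). A bitwise mask then selects
the places in question.
-/

/-! ### The happy function of a random number -/

lemma happyMap_ten_mul_add (q d : ℕ) (hd : d < 10) :
    happyMap 2 10 (10 * q + d) = happyMap 2 10 q + d ^ 2 := by
  rcases Nat.eq_zero_or_pos (10 * q + d) with h | h
  · obtain rfl : q = 0 := by omega
    obtain rfl : d = 0 := by omega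
    simp [happyMap]
  · have h1 : (10 * q + d) % 10 = d := by omega
    have h2 : (10 * q + d) / 10 = q := by omega
    simp only [happyMap]
    rw [Nat.digits_def' (by norm_num) h, h1, h2]
    simp [add_comm]

lemma happyMap_zero : happyMap 2 10 0 = 0 := by simp [happyMap]

lemma sum_range_mul_eq {R : Type*} [AddCommMonoid R] (f : ℕ → R) (a b : ℕ) :
    ∑ n ∈ Finset.range (a * b), f n
      = ∑ q ∈ Finset.range b, ∑ r ∈ Finset.range a, f (a * q + r) := by
  induction b with
  | zero => simp
  | succ b ih => rw [Nat.mul_succ, Finset.sum_range_add, ih, Finset.sum_range_succ]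

/-- The expectation of `g (happyMap 2 10 n)` for `n` uniform in `[0, 10 ^ m)`. -/
noncomputable def happyMean (m : ℕ) (g : ℕ → ℝ) : ℝ :=
  (∑ n ∈ Finset.range (10 ^ m), g (happyMap 2 10 n)) / 10 ^ m

lemma happyMean_zero (g : ℕ → ℝ) : happyMean 0 g = g 0 := by
  simp [happyMean, happyMap_zero]

/-- Conditioning on the last digit. -/
lemma happyMean_succ (m : ℕ) (g : ℕ → ℝ) :
    happyMean (m + 1) g
      = (∑ d ∈ Finset.range 10, happyMean m (fun h => g (h + d ^ 2))) / 10 := by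
  simp only [happyMean]
  rw [pow_succ' 10 m, sum_range_mul_eq, Finset.sum_comm, ← Finset.sum_div, div_div, pow_succ']
  rw [mul_comm ((10 : ℝ) ^ m)]
  congr 1
  refine Finset.sum_congr rfl fun d hd => Finset.sum_congr rfl fun q _ => ?_
  rw [happyMap_ten_mul_add _ _ (Finset.mem_range.1 hd)]

lemma happyMean_mono (m : ℕ) {f g : ℕ → ℝ} (h : ∀ x, f x ≤ g x) :
    happyMean m f ≤ happyMean m g := by
  unfold happyMean
  gcongr
  exact h _

lemma happyMean_add (m : ℕ) (f g : ℕ → ℝ) :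
    happyMean m (fun x => f x + g x) = happyMean m f + happyMean m g := by
  simp only [happyMean, Finset.sum_add_distrib, add_div]

lemma happyMean_sum {ι : Type*} (m : ℕ) (s : Finset ι) (f : ι → ℕ → ℝ) :
    happyMean m (fun x => ∑ i ∈ s, f i x) = ∑ i ∈ s, happyMean m (f i) := by
  simp only [happyMean]
  rw [Finset.sum_comm, Finset.sum_div]

lemma happyMean_const (m : ℕ) (c : ℝ) : happyMean m (fun _ => c) = c := by
  simp [happyMean]

lemma happyMean_mul_right (m : ℕ) (f : ℕ → ℝ) (c : ℝ) :
    happyMean m (fun x => f x * c) = happyMean m f * c := by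
  simp only [happyMean]
  rw [← Finset.sum_mul]
  ring

/-- The square of a uniform decimal digit has mean `57 / 2` and variance `14421 / 20`, so the happy
function of a random `m`-digit number has mean `57 / 2 * m` and variance `14421 / 20 * m`. -/
lemma happyMean_sq_sub (m : ℕ) (a : ℝ) :
    happyMean m (fun h => ((h : ℝ) - a) ^ 2) = m * (14421 / 20) + (57 / 2 * m - a) ^ 2 := by
  induction m generalizing a with
  | zero => simp [happyMean_zero]
  | succ m ih =>
    rw [happyMean_succ]
    have : ∀ d : ℕ, happyMean m (fun h => (((h + d ^ 2 : ℕ) : ℝ) - a) ^ 2)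
        = m * (14421 / 20) + (57 / 2 * m - (a - (d : ℝ) ^ 2)) ^ 2 := by
      intro d
      rw [← ih]
      congr 1
      ext h
      push_cast
      ring
    simp only [this]
    simp only [Finset.sum_range_succ, Finset.sum_range_zero]
    push_cast
    ring

/-- Chebyshev's inequality for the upper tail. -/
lemma happyMean_tail_le (m : ℕ) {N t : ℝ} (ht : 0 < t) (hN : 57 / 2 * m + t ≤ N) :
    happyMean m (fun h => if N ≤ (h : ℝ) then 1 else 0) ≤ m * (14421 / 20) / t ^ 2 := by
  have h1 : happyMean m (fun h => if N ≤ (h : ℝ) then 1 else 0)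
      ≤ happyMean m (fun h => ((h : ℝ) - 57 / 2 * m) ^ 2 * (1 / t ^ 2)) := by
    refine happyMean_mono m fun h => ?_
    split_ifs with hh
    · rw [mul_one_div, one_le_div (by positivity)]
      exact pow_le_pow_left₀ ht.le (by linarith) 2
    · positivity
  rw [happyMean_mul_right, happyMean_sq_sub] at h1
  refine h1.trans (le_of_eq ?_)
  ring

/-! ### The renewal function of the squares of the digits -/

/-- The renewal function of the random walk whose steps are squares of uniform decimal digits:
the expected number of visits to `h`, given by its generating function
`1 / (1 - ∑ d < 10, X ^ d² / 10)`. -/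
noncomputable def renewal (h : ℕ) : ℝ :=
  PowerSeries.coeff h
    (1 - PowerSeries.C (1 / 10 : ℝ) * ∑ d ∈ Finset.range 10, PowerSeries.X ^ (d ^ 2))⁻¹

lemma renewal_series_mul :
    (1 - PowerSeries.C (1 / 10 : ℝ) * ∑ d ∈ Finset.range 10, PowerSeries.X ^ (d ^ 2))
      * PowerSeries.mk renewal = 1 := by
  have : PowerSeries.mk renewal =
      (1 - PowerSeries.C (1 / 10 : ℝ) * ∑ d ∈ Finset.range 10, PowerSeries.X ^ (d ^ 2))⁻¹ := by
    ext n
    simp [renewal]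
  rw [this]
  apply PowerSeries.mul_inv_cancel
  simp [Finset.sum_range_succ]
  norm_num

lemma renewal_eq (h : ℕ) :
    renewal h = (if h = 0 then 1 else 0)
      + (∑ d ∈ Finset.range 10, if d ^ 2 ≤ h then renewal (h - d ^ 2) else 0) / 10 := by
  have := congrArg (PowerSeries.coeff h) renewal_series_mul
  rw [sub_mul, one_mul, mul_assoc, map_sub, PowerSeries.coeff_C_mul, Finset.sum_mul, map_sum,
    PowerSeries.coeff_mk, PowerSeries.coeff_one] at this
  simp only [PowerSeries.coeff_X_pow_mul', PowerSeries.coeff_mk] at this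
  linarith

/-- The walk makes exactly one step from `[0, h]` to `(h, ∞)`: the expected number of such steps,
sorted by the distance `j` of their starting point from `h`, is `1`. -/
lemma renewal_identity (h : ℕ) :
    (∑ d ∈ Finset.range 10, ∑ j ∈ Finset.range (d ^ 2),
      if j ≤ h then renewal (h - j) else 0) / 10 = 1 := by
  set Q : PowerSeries ℝ := PowerSeries.C (1 / 10 : ℝ) *
    ∑ d ∈ Finset.range 10, ∑ j ∈ Finset.range (d ^ 2), PowerSeries.X ^ j with hQ
  have hC : (PowerSeries.C (1 / 10 : ℝ)) * 10 = 1 := by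
    rw [← map_ofNat (PowerSeries.C (R := ℝ)) 10, ← map_mul]
    norm_num
  have h1 : (1 - PowerSeries.X) * Q = 1 - PowerSeries.C (1 / 10 : ℝ) *
      ∑ d ∈ Finset.range 10, PowerSeries.X ^ (d ^ 2) := by
    rw [hQ, mul_left_comm, Finset.mul_sum]
    simp only [mul_neg_geom_sum]
    rw [Finset.sum_sub_distrib, mul_sub]
    simp only [Finset.sum_const, Finset.card_range, nsmul_eq_mul, mul_one, Nat.cast_ofNat, hC]
  have h2 : (1 - PowerSeries.X) * (Q * PowerSeries.mk renewal) = 1 := by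
    rw [← mul_assoc, h1, renewal_series_mul]
  have h3 : Q * PowerSeries.mk renewal = PowerSeries.mk 1 := by
    have h4 := PowerSeries.mk_one_mul_one_sub_eq_one ℝ
    calc Q * PowerSeries.mk renewal
        = (PowerSeries.mk 1 * (1 - PowerSeries.X)) * (Q * PowerSeries.mk renewal) := by
          rw [h4, one_mul]
      _ = _ := by rw [mul_assoc, h2, mul_one]
  have h5 := congrArg (PowerSeries.coeff h) h3
  rw [hQ, mul_assoc, PowerSeries.coeff_C_mul, Finset.sum_mul, map_sum] at h5
  simp only [Finset.sum_mul, map_sum, PowerSeries.coeff_X_pow_mul', PowerSeries.coeff_mk,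
    Pi.one_apply] at h5
  linarith

lemma renewal_zero : renewal 0 = 10 / 9 := by
  have := renewal_eq 0
  simp at this
  linarith

lemma renewal_of_pos {h : ℕ} (hh : 0 < h) :
    renewal h
      = (∑ d ∈ Finset.Icc 1 9, if d ^ 2 ≤ h then renewal (h - d ^ 2) else 0) / 9 := by
  have := renewal_eq h
  rw [Finset.sum_range_succ', if_neg hh.ne'] at this
  have e : ∑ d ∈ Finset.Icc 1 9, (if d ^ 2 ≤ h then renewal (h - d ^ 2) else 0)
      = ∑ d ∈ Finset.range 9, if (d + 1) ^ 2 ≤ h then renewal (h - (d + 1) ^ 2) else 0 := by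
    rw [Finset.range_eq_Ico]
    exact (Finset.sum_Ico_add' (fun d => if d ^ 2 ≤ h then renewal (h - d ^ 2) else 0) 0 9 1).symm
  rw [e]
  simp at this ⊢
  linarith

lemma renewal_mem_Icc (h : ℕ) : 0 ≤ renewal h ∧ renewal h ≤ 10 / 9 := by
  induction h using Nat.strong_induction_on with
  | _ h ih =>
    rcases Nat.eq_zero_or_pos h with rfl | hh
    · rw [renewal_zero]; norm_num
    · have key : ∀ d ∈ Finset.Icc 1 9, 0 ≤ (if d ^ 2 ≤ h then renewal (h - d ^ 2) else 0) ∧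
          (if d ^ 2 ≤ h then renewal (h - d ^ 2) else 0) ≤ 10 / 9 := by
        intro d hd
        have hd1 : 1 ≤ d ^ 2 := Nat.one_le_pow _ _ (Finset.mem_Icc.1 hd).1
        split_ifs
        · exact ih _ (by omega)
        · norm_num
      rw [renewal_of_pos hh]
      have h1 := Finset.sum_nonneg fun d hd => (key d hd).1
      have h2 := Finset.sum_le_sum fun d hd => (key d hd).2
      simp only [Finset.sum_const, Nat.card_Icc, nsmul_eq_mul] at h2
      norm_num at h2
      constructor <;> linarith

lemma renewal_eq_average {n : ℕ} (k : ℕ) :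
    renewal (n + 81 + k) = (∑ d ∈ Finset.Icc 1 9, renewal (n + 81 + k - d ^ 2)) / 9 := by
  rw [renewal_of_pos (by omega)]
  congr 1
  refine Finset.sum_congr rfl fun d hd => if_pos ?_
  have : d ^ 2 ≤ 9 ^ 2 := Nat.pow_le_pow_left (Finset.mem_Icc.1 hd).2 2
  omega

/-- Bounds on a window of length `81` persist, since later values are averages of earlier ones. -/
lemma renewal_bounds_persist {n : ℕ} {a b : ℝ}
    (hw : ∀ k < 81, a ≤ renewal (n + k) ∧ renewal (n + k) ≤ b) (k : ℕ) :
    a ≤ renewal (n + k) ∧ renewal (n + k) ≤ b := by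
  induction k using Nat.strong_induction_on with
  | _ k ih =>
    rcases lt_or_ge k 81 with hk | hk
    · exact hw k hk
    · obtain ⟨l, rfl⟩ := Nat.exists_eq_add_of_le hk
      rw [← add_assoc, renewal_eq_average]
      have key : ∀ d ∈ Finset.Icc 1 9,
          a ≤ renewal (n + 81 + l - d ^ 2) ∧ renewal (n + 81 + l - d ^ 2) ≤ b := by
        intro d hd
        have hd1 : 1 ≤ d ^ 2 := Nat.one_le_pow _ _ (Finset.mem_Icc.1 hd).1
        have hd2 : d ^ 2 ≤ 9 ^ 2 := Nat.pow_le_pow_left (Finset.mem_Icc.1 hd).2 2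
        have := ih (81 + l - d ^ 2) (by omega)
        rwa [show n + 81 + l - d ^ 2 = n + (81 + l - d ^ 2) by omega]
      have h1 := Finset.sum_le_sum fun d hd => (key d hd).1
      have h2 := Finset.sum_le_sum fun d hd => (key d hd).2
      simp only [Finset.sum_const, Nat.card_Icc, nsmul_eq_mul] at h1 h2
      norm_num at h1 h2
      constructor <;> linarith

/-- The deviation from either bound at the end of a window decays by at most the factor `9` per
step, because `1` is among the squares that are averaged over. -/
lemma renewal_deviation {n : ℕ} {a b : ℝ}
    (hw : ∀ k < 81, a ≤ renewal (n + k) ∧ renewal (n + k) ≤ b) (k : ℕ) :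
    a + (renewal (n + 80) - a) / 9 ^ k ≤ renewal (n + 80 + k) ∧
      renewal (n + 80 + k) ≤ b - (b - renewal (n + 80)) / 9 ^ k := by
  induction k with
  | zero => simp
  | succ k ih =>
    rw [show n + 80 + (k + 1) = n + 81 + k by ring, renewal_eq_average]
    have key : ∀ d ∈ Finset.Icc 2 9,
        a ≤ renewal (n + 81 + k - d ^ 2) ∧ renewal (n + 81 + k - d ^ 2) ≤ b := by
      intro d hd
      have hd2 : d ^ 2 ≤ 9 ^ 2 := Nat.pow_le_pow_left (Finset.mem_Icc.1 hd).2 2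
      have := renewal_bounds_persist hw (81 + k - d ^ 2)
      rwa [show n + 81 + k - d ^ 2 = n + (81 + k - d ^ 2) by omega]
    have h1 := Finset.sum_le_sum fun d hd => (key d hd).1
    have h2 := Finset.sum_le_sum fun d hd => (key d hd).2
    have e : ∑ d ∈ Finset.Icc 1 9, renewal (n + 81 + k - d ^ 2)
        = renewal (n + 80 + k) + ∑ d ∈ Finset.Icc 2 9, renewal (n + 81 + k - d ^ 2) := by
      rw [← Finset.add_sum_Ioc_eq_sum_Icc (by norm_num), show Finset.Ioc 1 9 = Finset.Icc 2 9 from rfl,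
        show n + 81 + k - 1 ^ 2 = n + 80 + k by omega]
    rw [e, pow_succ, ← div_div, ← div_div]
    simp only [Finset.sum_const, Nat.card_Icc, nsmul_eq_mul] at h1 h2
    norm_num at h1 h2
    obtain ⟨i1, i2⟩ := ih
    constructor <;> linarith

/-- The oscillation over windows of length `81` contracts. -/
lemma exists_renewal_window (j : ℕ) : ∃ a b : ℝ, b - a ≤ 10 / 9 * (1 - 1 / 9 ^ 81) ^ j ∧
    ∀ k < 81, a ≤ renewal (81 * j + k) ∧ renewal (81 * j + k) ≤ b := by
  induction j with
  | zero => exact ⟨0, 10 / 9, by norm_num, fun k _ => renewal_mem_Icc _⟩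
  | succ j ih =>
    obtain ⟨a, b, hab, hw⟩ := ih
    set x := renewal (81 * j + 80) with hx
    obtain ⟨hxa, hxb⟩ := hw 80 (by norm_num)
    refine ⟨a + (x - a) / 9 ^ 81, b - (b - x) / 9 ^ 81, ?_, fun k hk => ?_⟩
    · calc b - (b - x) / 9 ^ 81 - (a + (x - a) / 9 ^ 81) = (b - a) * (1 - 1 / 9 ^ 81) := by ring
        _ ≤ 10 / 9 * (1 - 1 / 9 ^ 81) ^ j * (1 - 1 / 9 ^ 81) := by
          gcongr
        _ = _ := by ring
    · obtain ⟨h1, h2⟩ := renewal_deviation hw (k + 1)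
      rw [show 81 * j + 80 + (k + 1) = 81 * (j + 1) + k by ring, ← hx] at h1 h2
      have hp : (9 : ℝ) ^ (k + 1) ≤ 9 ^ 81 := pow_le_pow_right₀ (by norm_num) (by omega)
      have h3 : (x - a) / 9 ^ 81 ≤ (x - a) / 9 ^ (k + 1) :=
        div_le_div_of_nonneg_left (by linarith) (by positivity) hp
      have h4 : (b - x) / 9 ^ 81 ≤ (b - x) / 9 ^ (k + 1) :=
        div_le_div_of_nonneg_left (by linarith) (by positivity) hp
      constructor <;> linarith

/-- The renewal identity expresses `1` as a sum of `285 / 10 = 57 / 2` weights times values of the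
renewal function in a window. -/
lemma renewal_window_lower_bound_le {n : ℕ} {a b : ℝ}
    (hw : ∀ k < 81, a ≤ renewal (n + k) ∧ renewal (n + k) ≤ b) : a ≤ 2 / 57 := by
  have h1 := renewal_identity (n + 80)
  have h2 : ∑ d ∈ Finset.range 10, ∑ j ∈ Finset.range (d ^ 2), a
      ≤ ∑ d ∈ Finset.range 10, ∑ j ∈ Finset.range (d ^ 2),
        if j ≤ n + 80 then renewal (n + 80 - j) else 0 := by
    refine Finset.sum_le_sum fun d hd => Finset.sum_le_sum fun j hj => ?_
    have hd2 : d ^ 2 ≤ 9 ^ 2 := Nat.pow_le_pow_left (by have := Finset.mem_range.1 hd; omega) 2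
    have hj2 := Finset.mem_range.1 hj
    rw [if_pos (by omega), show n + 80 - j = n + (80 - j) by omega]
    exact (hw _ (by omega)).1
  have h3 : ∑ d ∈ Finset.range 10, ∑ j ∈ Finset.range (d ^ 2), a = 285 * a := by
    simp only [Finset.sum_const, Finset.card_range, nsmul_eq_mul]
    rw [← Finset.sum_mul, ← Nat.cast_sum, show ∑ i ∈ Finset.range 10, i ^ 2 = 285 from rfl]
    norm_num
  linarith

/-- The renewal function tends to the reciprocal of the mean step, with an explicit rate;
`10 ^ 80` is a bound for `10 / 9 * 81 * 9 ^ 81`. -/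
lemma renewal_le {h : ℕ} (hh : 0 < h) : renewal h ≤ 2 / 57 + 10 ^ 80 / h := by
  obtain ⟨a, b, hab, hw⟩ := exists_renewal_window (h / 81)
  have ha := renewal_window_lower_bound_le hw
  have hb := (hw (h % 81) (Nat.mod_lt _ (by norm_num))).2
  rw [Nat.div_add_mod] at hb
  set j := h / 81 with hj
  have hj1 : (h : ℝ) ≤ 81 * (j + 1) := by
    have : h ≤ 81 * (j + 1) := by omega
    exact_mod_cast this
  have hh' : (0 : ℝ) < h := by exact_mod_cast hh
  -- Bernoulli's inequality gives `(1 - c) ^ j ≤ 1 / (1 + j c)`.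
  have key : (1 - 1 / 9 ^ 81 : ℝ) ^ j * (1 + j * (1 / 9 ^ 81)) ≤ 1 := by
    have h1 : 1 + (j : ℝ) * (1 / 9 ^ 81) ≤ (1 + 1 / 9 ^ 81) ^ j :=
      one_add_mul_le_pow (by norm_num) j
    calc (1 - 1 / 9 ^ 81 : ℝ) ^ j * (1 + j * (1 / 9 ^ 81))
        ≤ (1 - 1 / 9 ^ 81 : ℝ) ^ j * (1 + 1 / 9 ^ 81) ^ j := by
          gcongr
      _ = ((1 - 1 / 9 ^ 81) * (1 + 1 / 9 ^ 81)) ^ j := (mul_pow _ _ _).symm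
      _ ≤ 1 := pow_le_one₀ (by norm_num) (by norm_num)
  have hP : (0 : ℝ) ≤ (1 - 1 / 9 ^ 81) ^ j := pow_nonneg (by norm_num) _
  set P : ℝ := (1 - 1 / 9 ^ 81) ^ j
  have h2 : P * (h : ℝ) ≤ 81 * 9 ^ 81 := by
    have h3 : P * h ≤ P * (81 * 9 ^ 81 * (1 + j * (1 / 9 ^ 81))) := by
      refine mul_le_mul_of_nonneg_left (hj1.trans ?_) hP
      have : (81 * 9 ^ 81 * (1 + j * (1 / 9 ^ 81)) : ℝ) = 81 * (9 ^ 81 + j) := by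
        field_simp
      rw [this]
      have : (1 : ℝ) ≤ 9 ^ 81 := by norm_num
      linarith
    calc P * h ≤ _ := h3
      _ = 81 * 9 ^ 81 * (P * (1 + j * (1 / 9 ^ 81))) := by ring
      _ ≤ 81 * 9 ^ 81 * 1 := by gcongr
      _ = _ := mul_one _
  have h4 : 10 / 9 * P ≤ 10 ^ 80 / h := by
    rw [le_div_iff₀ hh']
    calc 10 / 9 * P * h = 10 / 9 * (P * h) := by ring
      _ ≤ 10 / 9 * (81 * 9 ^ 81) := by gcongr
      _ ≤ 10 ^ 80 := by norm_num
  linarith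

/-- The expected number of visits to `h` during the first `M` steps is at most the renewal
function. -/
lemma sum_happyMean_point_le (M h : ℕ) :
    ∑ m ∈ Finset.range M, happyMean m (fun x => if x = h then 1 else 0) ≤ renewal h := by
  induction M generalizing h with
  | zero => simpa using (renewal_mem_Icc h).1
  | succ M ih =>
    rw [Finset.sum_range_succ', happyMean_zero, renewal_eq h, add_comm]
    have e0 : (if 0 = h then (1 : ℝ) else 0) = if h = 0 then 1 else 0 := by
      simp only [eq_comm]
    rw [e0]
    gcongr
    simp only [happyMean_succ]
    rw [← Finset.sum_div, Finset.sum_comm]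
    gcongr with d hd
    split_ifs with hdh
    · refine le_trans (le_of_eq ?_) (ih (h - d ^ 2))
      refine Finset.sum_congr rfl fun m _ => ?_
      congr 1
      ext x
      congr 1
      simp only [eq_iff_iff]
      omega
    · refine le_of_eq (Finset.sum_eq_zero fun m _ => ?_)
      have : (fun x => if x + d ^ 2 = h then (1 : ℝ) else 0) = fun _ => 0 := by
        ext x
        rw [if_neg (by omega)]
      rw [this, happyMean_const]

/-! ### From one density to a later one -/

/-- The probability that the happy function of a random `m`-digit number lies in `B`. If `B` is
invariant under the happy function, this is the proportion of `B` in `[0, 10 ^ m)`. -/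
noncomputable def digitDensity (B : Set ℕ) (m : ℕ) : ℝ :=
  happyMean m (B.indicator fun _ => 1)

lemma indicator_one_mem_Icc (B : Set ℕ) (x : ℕ) :
    0 ≤ B.indicator (fun _ => (1 : ℝ)) x ∧ B.indicator (fun _ => (1 : ℝ)) x ≤ 1 := by
  classical
  rw [Set.indicator_apply]
  split_ifs <;> norm_num

lemma digitDensity_mem_Icc (B : Set ℕ) (m : ℕ) :
    0 ≤ digitDensity B m ∧ digitDensity B m ≤ 1 := by
  have h0 := happyMean_mono m fun x => (indicator_one_mem_Icc B x).1
  have h1 := happyMean_mono m fun x => (indicator_one_mem_Icc B x).2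
  rw [happyMean_const] at h0 h1
  exact ⟨h0, h1⟩

/-- The contribution of the visits to `B` below `N` is bounded by the renewal function, that of the
places from `N` on by Chebyshev's inequality. -/
lemma sum_digitDensity_le (B : Set ℕ) (M N : ℕ) {t : ℝ} (ht : 0 < t)
    (hN : 57 / 2 * (M : ℝ) + t ≤ N) :
    ∑ m ∈ Finset.range M, digitDensity B m
      ≤ ∑ h ∈ Finset.range N, renewal h * B.indicator (fun _ => 1) h
        + M * (M * (14421 / 20) / t ^ 2) := by
  have key : ∀ m ∈ Finset.range M, digitDensity B m
      ≤ ∑ h ∈ Finset.range N, happyMean m (fun x => if x = h then 1 else 0)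
          * B.indicator (fun _ => 1) h + M * (14421 / 20) / t ^ 2 := by
    intro m hm
    have hmM : (m : ℝ) ≤ M := by exact_mod_cast (Finset.mem_range.1 hm).le
    have h1 : ∀ x : ℕ, B.indicator (fun _ => (1 : ℝ)) x
        ≤ ∑ h ∈ Finset.range N, (if x = h then 1 else 0) * B.indicator (fun _ => (1 : ℝ)) h
          + if (N : ℝ) ≤ (x : ℝ) then 1 else 0 := by
      intro x
      simp only [ite_mul, one_mul, zero_mul, Finset.sum_ite_eq, Finset.mem_range, Nat.cast_le]
      have := (indicator_one_mem_Icc B x).2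
      split_ifs with h1 h2 <;> first | omega | linarith
    have h2 := happyMean_mono m h1
    rw [happyMean_add, happyMean_sum] at h2
    simp only [happyMean_mul_right] at h2
    have h3 := happyMean_tail_le m (N := N) ht (by linarith)
    have h4 : m * (14421 / 20) / t ^ 2 ≤ M * (14421 / 20) / t ^ 2 := by gcongr
    exact h2.trans (by linarith)
  refine (Finset.sum_le_sum key).trans ?_
  rw [Finset.sum_add_distrib, Finset.sum_comm]
  simp only [← Finset.sum_mul, Finset.sum_const, Finset.card_range, nsmul_eq_mul]
  gcongr with h _
  · exact (indicator_one_mem_Icc B h).1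
  · exact sum_happyMean_point_le M h

/-- Below `L` the trivial bound for the renewal function is used, from `L` on the renewal theorem. -/
lemma sum_renewal_mul_le (B : Set ℕ) (N : ℕ) {L : ℕ} (hL : 0 < L) :
    ∑ h ∈ Finset.range N, renewal h * B.indicator (fun _ => 1) h
      ≤ 10 / 9 * L
        + (2 / 57 + 10 ^ 80 / L) * ∑ h ∈ Finset.range N, B.indicator (fun _ => 1) h := by
  have key : ∀ h ∈ Finset.range N, renewal h * B.indicator (fun _ => 1) h
      ≤ (if h ∈ Finset.range L then 10 / 9 else 0)
        + (2 / 57 + 10 ^ 80 / (L : ℝ)) * B.indicator (fun _ => 1) h := by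
    intro h _
    obtain ⟨h0, h1⟩ := indicator_one_mem_Icc B h
    obtain ⟨r0, r1⟩ := renewal_mem_Icc h
    split_ifs with hh
    · have : renewal h * B.indicator (fun _ => 1) h ≤ 10 / 9 * 1 := by gcongr
      have : 0 ≤ (2 / 57 + 10 ^ 80 / (L : ℝ)) * B.indicator (fun _ => 1) h := by positivity
      linarith
    · rw [Finset.mem_range, not_lt] at hh
      rw [zero_add]
      gcongr
      exact (renewal_le (hL.trans_le hh)).trans (by gcongr)
  refine (Finset.sum_le_sum key).trans ?_
  rw [Finset.sum_add_distrib, ← Finset.mul_sum]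
  gcongr
  rw [← Finset.sum_filter, Finset.sum_const, nsmul_eq_mul, mul_comm]
  gcongr
  calc ((Finset.range N).filter (· ∈ Finset.range L)).card ≤ (Finset.range L).card :=
        Finset.card_le_card fun x hx => (Finset.mem_filter.1 hx).2
    _ = L := Finset.card_range L

lemma sum_indicator_eq {B : Set ℕ} (hB : ∀ n, happyMap 2 10 n ∈ B ↔ n ∈ B) (k : ℕ) :
    ∑ h ∈ Finset.range (10 ^ k), B.indicator (fun _ => (1 : ℝ)) h
      = 10 ^ k * digitDensity B k := by
  rw [digitDensity, happyMean, mul_div_cancel₀ _ (by positivity)]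
  classical
  refine Finset.sum_congr rfl fun h _ => ?_
  simp only [Set.indicator_apply, hB]

/-- The densities of an invariant set over `[0, 10 ^ m)`, averaged over `m` up to about
`2 / 57 * 10 ^ k`, are close to its density over `[0, 10 ^ k)`; hence one of them, with large `m`,
does not exceed the latter by much. -/
lemma exists_digitDensity_le {B : Set ℕ} (hB : ∀ n, happyMap 2 10 n ∈ B ↔ n ∈ B) {k : ℕ}
    (hk : 400 ≤ k) :
    ∃ m, k + 8 ≤ m ∧ digitDensity B m ≤ digitDensity B k + 100 / 10 ^ (k / 8) := by
  set q := k / 8 with hq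
  have hq50 : 50 ≤ q := by omega
  set x : ℝ := 10 ^ q with hx
  set N : ℝ := 10 ^ k with hNdef
  set b := digitDensity B k with hb
  obtain ⟨hb0, hb1⟩ := digitDensity_mem_Icc B k
  rw [← hb] at hb0 hb1
  have hx50 : (10 : ℝ) ^ 50 ≤ x := pow_le_pow_right₀ (by norm_num) hq50
  have hx0 : 0 < x := by positivity
  have hN0 : 0 < N := by positivity
  have hNx : x ^ 8 ≤ N := by
    rw [hx, ← pow_mul, hNdef]
    exact pow_le_pow_right₀ (by norm_num) (by omega)
  -- Only `m ≥ L` are considered, and `L` is also the place from which the renewal estimate is used.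
  set L : ℕ := 10 ^ (4 * q) with hL
  have hLx : (L : ℝ) = x ^ 4 := by
    rw [hL, hx, ← pow_mul, mul_comm q]
    push_cast
    rfl
  have hkL : k + 8 ≤ L := by
    have h1 : 1 + (4 * q) * 9 ≤ (1 + 9) ^ (4 * q) := by
      have := one_add_mul_le_pow (R := ℤ) (a := 9) (by norm_num) (4 * q)
      exact_mod_cast this
    have h2 : (1 + 9) ^ (4 * q) = L := by norm_num [hL]
    omega
  -- With this `M` the mean `57 / 2 * m` for `m < M` stays `N / x` below `N`, as needed for the
  -- Chebyshev bound on the tail.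
  set M : ℕ := ⌊2 / 57 * (N - N / x)⌋₊ with hM
  have hxN : N / x ≤ N := div_le_self hN0.le (le_trans (by norm_num) hx50)
  have hM1 : (M : ℝ) ≤ 2 / 57 * (N - N / x) := Nat.floor_le (by linarith)
  have hM2 : 2 / 57 * (N - N / x) - 1 ≤ M := (Nat.sub_one_lt_floor _).le
  by_contra! hcon
  have hlarge : ∀ m ∈ Finset.Ico L M, b + 100 / x ≤ digitDensity B m := fun m hm =>
    (hcon m (hkL.trans (Finset.mem_Ico.1 hm).1)).le
  have hlow : ((M : ℝ) - L) * (b + 100 / x) ≤ ∑ m ∈ Finset.range M, digitDensity B m := by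
    have h1 := Finset.card_nsmul_le_sum _ _ _ hlarge
    rw [Nat.card_Ico, nsmul_eq_mul] at h1
    have h2 : ∑ m ∈ Finset.Ico L M, digitDensity B m ≤ ∑ m ∈ Finset.range M, digitDensity B m := by
      refine Finset.sum_le_sum_of_subset_of_nonneg ?_ fun m _ _ => (digitDensity_mem_Icc B m).1
      rw [Finset.range_eq_Ico]
      exact Finset.Ico_subset_Ico_left (Nat.zero_le _)
    have h3 : (M : ℝ) - L ≤ ((M - L : ℕ) : ℝ) := by
      rw [sub_le_iff_le_add]
      exact_mod_cast le_tsub_add (a := L) (b := M)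
    calc _ ≤ ((M - L : ℕ) : ℝ) * (b + 100 / x) := by gcongr
      _ ≤ _ := h1.trans h2
  have hup := sum_digitDensity_le B M (10 ^ k) (t := N / x) (by positivity) (by
    push_cast
    rw [← hNdef]
    linarith)
  have hren := sum_renewal_mul_le B (10 ^ k) (L := L) (by positivity)
  rw [sum_indicator_eq hB, ← hNdef, ← hb] at hren
  -- Every error term is a small multiple of `N * δ`.
  set δ : ℝ := 1 / x with hδ
  have hδ0 : 0 < δ := by positivity
  have hδ1 : δ ≤ 1 / 1000 := by
    rw [hδ]
    exact one_div_le_one_div_of_le (by norm_num) (le_trans (by norm_num) hx50)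
  have hNδ : x ^ 7 ≤ N * δ := by
    rw [hδ, mul_one_div, le_div_iff₀ hx0]
    linarith [pow_succ x 7]
  have hx1 : 1000 ≤ x := le_trans (by norm_num) hx50
  have e4 : (L : ℝ) ≤ N * δ / 1000 := by
    rw [hLx, le_div_iff₀ (by norm_num)]
    calc x ^ 4 * 1000 ≤ x ^ 4 * x ^ 1 := by gcongr; simpa using hx1
      _ = x ^ 5 := by ring
      _ ≤ x ^ 7 := pow_le_pow_right₀ (by linarith) (by norm_num)
      _ ≤ _ := hNδ
  have e2 : x ^ 2 ≤ N * δ / 1000 :=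
    le_trans (by rw [hLx]; exact pow_le_pow_right₀ (by linarith) (by norm_num)) e4
  have e0 : 1 ≤ N * δ / 1000 := le_trans (one_le_pow₀ (by linarith)) e2
  have eC : 10 ^ 80 / (L : ℝ) ≤ δ / 1000 := by
    rw [hLx, hδ, div_div, div_le_div_iff₀ (by positivity) (by positivity)]
    calc (10 : ℝ) ^ 80 * (x * 1000) ≤ (10 ^ 50) ^ 3 * x := by nlinarith
      _ ≤ x ^ 3 * x := by gcongr
      _ = 1 * x ^ 4 := by ring
  have eV : (M : ℝ) * (M * (14421 / 20) / (N / x) ^ 2) ≤ x ^ 2 := by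
    have h1 : (M : ℝ) ≤ 2 / 57 * N := by
      have : 0 ≤ N / x := by positivity
      linarith
    have h2 : (M : ℝ) ^ 2 ≤ (2 / 57 * N) ^ 2 := by gcongr
    have h3 : (M : ℝ) * (M * (14421 / 20) / (N / x) ^ 2)
        = M ^ 2 * (14421 / 20) / N ^ 2 * x ^ 2 := by
      field_simp
    rw [h3]
    have h4 : (M : ℝ) ^ 2 * (14421 / 20) / N ^ 2 ≤ 1 := by
      rw [div_le_one (by positivity)]
      nlinarith [sq_nonneg N]
    calc _ ≤ 1 * x ^ 2 := by gcongr
      _ = _ := one_mul _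
  have hdiv : N / x = N * δ := by rw [hδ, mul_one_div]
  have hdiv' : 100 / x = 100 * δ := by rw [hδ, mul_one_div]
  rw [hdiv] at hM2
  rw [hdiv'] at hlow
  have l1 : (2 / 57 * (N - N * δ) - N * δ / 500) * (b + 100 * δ) ≤ (M - L) * (b + 100 * δ) :=
    mul_le_mul_of_nonneg_right (by linarith) (by positivity)
  have l2 : (2 / 57 + 10 ^ 80 / (L : ℝ)) * (N * b) ≤ (2 / 57 + δ / 1000) * (N * b) := by
    gcongr
  have l3 : (2 / 57 * (N - N * δ) - N * δ / 500) * (b + 100 * δ)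
      ≤ 10 / 9 * (N * δ / 1000) + (2 / 57 + δ / 1000) * (N * b) + N * δ / 1000 := by linarith
  have l4 : ((2 / 57 * (1 - δ) - δ / 500) * (b + 100 * δ)) * N
      ≤ (10 / 9 * (δ / 1000) + (2 / 57 + δ / 1000) * b + δ / 1000) * N := by linarith
  have l5 := le_of_mul_le_mul_right l4 hN0
  have m1 : δ * b ≤ δ := mul_le_of_le_one_right hδ0.le hb1
  have m2 : δ * δ ≤ δ / 1000 := by
    rw [div_eq_mul_one_div]
    gcongr
  linarith

/-- The errors made in passing from one density to a later one sum up to a tiny amount. -/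
lemma frequently_digitDensity_le {B : Set ℕ} (hB : ∀ n, happyMap 2 10 n ∈ B ↔ n ∈ B) {k : ℕ}
    (hk : 400 ≤ k) {γ : ℝ} (hγ : digitDensity B k + 200 / 10 ^ (k / 8) ≤ γ) :
    ∃ᶠ m in atTop, digitDensity B m ≤ γ := by
  have main : ∀ i, ∃ m, 400 + i ≤ m ∧ digitDensity B m + 200 / 10 ^ (m / 8) ≤ γ := by
    intro i
    induction i with
    | zero => exact ⟨k, hk, hγ⟩
    | succ i ih =>
      obtain ⟨m, hm, hmγ⟩ := ih
      obtain ⟨n, hn, hnm⟩ := exists_digitDensity_le hB (k := m) (by omega)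
      refine ⟨n, by omega, ?_⟩
      have h1 : (200 : ℝ) / 10 ^ (n / 8) ≤ 200 / 10 ^ (m / 8 + 1) := by
        gcongr
        · norm_num
        · omega
      rw [pow_succ, ← div_div] at h1
      have h2 : (100 : ℝ) / 10 ^ (m / 8) = 200 / 10 ^ (m / 8) / 2 := by ring
      have h3 : (0 : ℝ) ≤ 200 / 10 ^ (m / 8) := by positivity
      linarith
  rw [frequently_atTop]
  intro a
  obtain ⟨m, hm, hmγ⟩ := main a
  have : (0 : ℝ) ≤ 200 / 10 ^ (m / 8) := by positivity
  exact ⟨m, by omega, by linarith⟩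

/-! ### Distribution of the happy function as a polynomial -/

/-- The polynomial whose coefficient at `h` is the number of `n < 10 ^ m` with
`happyMap 2 10 n = h`. -/
noncomputable def happyPoly (m : ℕ) : Polynomial ℕ :=
  (∑ d ∈ Finset.range 10, Polynomial.X ^ (d ^ 2)) ^ m

lemma happyPoly_eq_sum (m : ℕ) :
    happyPoly m = ∑ n ∈ Finset.range (10 ^ m), Polynomial.X ^ happyMap 2 10 n := by
  induction m with
  | zero => simp [happyPoly, happyMap_zero]
  | succ m ih =>
    rw [happyPoly, pow_succ, ← happyPoly, ih, pow_succ' 10 m, sum_range_mul_eq, Finset.sum_mul_sum]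
    refine Finset.sum_congr rfl fun q _ => Finset.sum_congr rfl fun d hd => ?_
    rw [happyMap_ten_mul_add _ _ (Finset.mem_range.1 hd), pow_add]

lemma sum_happyPoly_coeff_le {B : Set ℕ} {F : Finset ℕ} (hF : ∀ h ∈ F, h ∈ B) (m : ℕ) :
    ((∑ h ∈ F, (happyPoly m).coeff h : ℕ) : ℝ) ≤ 10 ^ m * digitDensity B m := by
  rw [digitDensity, happyMean, mul_div_cancel₀ _ (by positivity)]
  simp only [happyPoly_eq_sum, Polynomial.finsetSum_coeff, Polynomial.coeff_X_pow]
  rw [Finset.sum_comm]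
  push_cast
  refine Finset.sum_le_sum fun n _ => ?_
  rw [Finset.sum_ite_eq']
  split_ifs with h
  · rw [Set.indicator_of_mem (hF _ h)]
  · exact (indicator_one_mem_Icc B _).1

lemma coeff_le_eval_one (p : Polynomial ℕ) (i : ℕ) : p.coeff i ≤ p.eval 1 := by
  rw [Polynomial.eval_eq_sum_range]
  simp only [one_pow, mul_one]
  rcases le_or_gt i p.natDegree with h | h
  · exact Finset.single_le_sum (f := p.coeff) (fun _ _ => Nat.zero_le _)
      (Finset.mem_range.2 (Nat.lt_succ_of_le h))
  · rw [Polynomial.coeff_eq_zero_of_natDegree_lt h]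
    exact Nat.zero_le _

lemma happyPoly_coeff_le (m h : ℕ) : (happyPoly m).coeff h ≤ 10 ^ m :=
  (coeff_le_eval_one _ _).trans (by simp [happyPoly, Polynomial.eval_finsetSum])

/-- Convolution with shifted indices; the terms below the shifts are dropped. -/
lemma sum_antidiagonal_happyPoly_le (m o k : ℕ) :
    ∑ ij ∈ Finset.HasAntidiagonal.antidiagonal k,
        (happyPoly m).coeff (ij.1 + o) * (happyPoly m).coeff (ij.2 + o)
      ≤ (happyPoly (2 * m)).coeff (k + 2 * o) := by
  have h : happyPoly (2 * m) = happyPoly m * happyPoly m := by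
    simp only [happyPoly]
    ring
  rw [h, Polynomial.coeff_mul]
  rw [← Finset.sum_image (s := Finset.HasAntidiagonal.antidiagonal k) (g := fun ij : ℕ × ℕ => (ij.1 + o, ij.2 + o))
    (f := fun ij => (happyPoly m).coeff ij.1 * (happyPoly m).coeff ij.2)]
  · refine Finset.sum_le_sum_of_subset fun x hx => ?_
    obtain ⟨ij, hij, rfl⟩ := Finset.mem_image.1 hx
    rw [Finset.HasAntidiagonal.mem_antidiagonal] at hij ⊢
    dsimp only
    omega
  · rintro ⟨a, b⟩ _ ⟨c, d⟩ _ hab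
    simp only [Prod.mk.injEq, add_left_inj] at hab
    exact Prod.ext hab.1 hab.2

/-! ### Polynomials packed into a single natural number -/

/-- The `i`-th digit of `X` in base `2 ^ K`. -/
def slot (K X i : ℕ) : ℕ := X / 2 ^ (K * i) % 2 ^ K

lemma slot_zero (K X : ℕ) : slot K X 0 = X % 2 ^ K := by simp [slot]

lemma slot_succ (K X i : ℕ) : slot K X (i + 1) = slot K (X / 2 ^ K) i := by
  rw [slot, slot, Nat.div_div_eq_div_mul, ← pow_add, Nat.mul_succ, add_comm]

lemma slot_eval {K : ℕ} (p : Polynomial ℕ) (hp : ∀ i, p.coeff i < 2 ^ K) (i : ℕ) :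
    slot K (p.eval (2 ^ K)) i = p.coeff i := by
  have hB : 0 < 2 ^ K := by positivity
  induction i generalizing p with
  | zero =>
    conv_lhs => rw [← Polynomial.divX_mul_X_add p]
    simp only [Polynomial.eval_add, Polynomial.eval_mul, Polynomial.eval_X, Polynomial.eval_C]
    rw [slot_zero, Nat.mul_add_mod', Nat.mod_eq_of_lt (hp 0)]
  | succ i ih =>
    conv_lhs => rw [← Polynomial.divX_mul_X_add p]
    simp only [Polynomial.eval_add, Polynomial.eval_mul, Polynomial.eval_X, Polynomial.eval_C]
    rw [slot_succ, mul_comm, Nat.mul_add_div hB, Nat.div_eq_of_lt (hp 0), add_zero,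
      ih _ fun j => by rw [Polynomial.coeff_divX]; exact hp _, Polynomial.coeff_divX]

lemma exists_poly_coeff_eq_slot {K : ℕ} (hK : 0 < K) (X : ℕ) :
    ∃ p : Polynomial ℕ, p.eval (2 ^ K) = X ∧ ∀ i, p.coeff i = slot K X i := by
  induction X using Nat.strong_induction_on with
  | _ X ih =>
    rcases Nat.eq_zero_or_pos X with rfl | hX
    · exact ⟨0, by simp, fun i => by simp [slot]⟩
    · obtain ⟨p, hp, hc⟩ := ih (X / 2 ^ K) (Nat.div_lt_self hX (Nat.one_lt_two_pow hK.ne'))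
      refine ⟨p * Polynomial.X + Polynomial.C (X % 2 ^ K), ?_, fun i => ?_⟩
      · simp [hp, Nat.div_add_mod']
      · cases i with
        | zero => simp [slot_zero]
        | succ i => simp [slot_succ, hc]

lemma slot_land (K X Y i : ℕ) : slot K (X &&& Y) i = slot K X i &&& slot K Y i := by
  simp only [slot, ← Nat.shiftRight_eq_div_pow, Nat.shiftRight_and_distrib, Nat.and_mod_two_pow]

/-- Casting out `2 ^ K - 1`: a number is congruent to the sum of its digits in base `2 ^ K`. -/
lemma mod_le_eval_one (K : ℕ) (p : Polynomial ℕ) : p.eval (2 ^ K) % (2 ^ K - 1) ≤ p.eval 1 := by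
  have h : p.eval (2 ^ K) ≡ p.eval 1 [MOD (2 ^ K - 1)] := by
    rw [← ZMod.natCast_eq_natCast_iff, Polynomial.eval_eq_sum_range, Polynomial.eval_eq_sum_range]
    have : ((2 ^ K : ℕ) : ZMod (2 ^ K - 1)) = 1 := by
      have h1 : 2 ^ K = (2 ^ K - 1) + 1 := (Nat.sub_add_cancel Nat.one_le_two_pow).symm
      rw [h1, Nat.cast_add, ZMod.natCast_self]
      simp
    simp only [Nat.cast_sum, Nat.cast_mul, Nat.cast_pow, this, Nat.cast_one, one_pow]
  rw [h]
  exact Nat.mod_le _ _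

/-- `X` packs, in base `2 ^ K`, a lower bound for the distribution of the happy function of
`m`-digit numbers: `s` times the digit at place `i` is at most the number of `n < 10 ^ m` with
`happyMap 2 10 n = i + o`. -/
def PackedBound (K m o s X : ℕ) : Prop :=
  ∀ i, s * slot K X i ≤ (happyPoly m).coeff (i + o)

lemma packedBound_pow {K m : ℕ} (hm : 10 ^ m < 2 ^ K) :
    PackedBound K m 0 1 ((∑ d ∈ Finset.range 10, (2 ^ K) ^ d ^ 2) ^ m) := by
  intro i
  have h : (∑ d ∈ Finset.range 10, (2 ^ K) ^ d ^ 2) ^ m = (happyPoly m).eval (2 ^ K) := by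
    simp only [happyPoly, Polynomial.eval_pow, Polynomial.eval_finsetSum, Polynomial.eval_X]
  rw [h, slot_eval _ fun i => (happyPoly_coeff_le m i).trans_lt hm, one_mul, add_zero]

/-- The condition on `s` makes the coefficients of the squared polynomial smaller than `2 ^ K`, so
that they are the digits of `X ^ 2`. -/
lemma PackedBound.sq {K m o s X : ℕ} (h : PackedBound K m o s X) (hK : 0 < K)
    (hs : 10 ^ (2 * m) < s ^ 2 * 2 ^ K) : PackedBound K (2 * m) (2 * o) (s ^ 2) (X ^ 2) := by
  obtain ⟨p, rfl, hc⟩ := exists_poly_coeff_eq_slot hK X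
  have key : ∀ k, s ^ 2 * (p ^ 2).coeff k ≤ (happyPoly (2 * m)).coeff (k + 2 * o) := by
    intro k
    refine le_trans ?_ (sum_antidiagonal_happyPoly_le m o k)
    rw [pow_two p, Polynomial.coeff_mul, Finset.mul_sum]
    refine Finset.sum_le_sum fun ij _ => ?_
    rw [hc, hc, pow_two, mul_mul_mul_comm]
    exact Nat.mul_le_mul (h _) (h _)
  have hlt : ∀ k, (p ^ 2).coeff k < 2 ^ K := fun k =>
    lt_of_mul_lt_mul_left' (((key k).trans (happyPoly_coeff_le _ _)).trans_lt hs)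
  intro k
  rw [← Polynomial.eval_pow, slot_eval _ hlt]
  exact key k

/-- The number with `n` digits `c` in base `2 ^ K`. -/
def repDigit (K n c : ℕ) : ℕ := (2 ^ (K * n) - 1) / (2 ^ K - 1) * c

lemma slot_repDigit {K c : ℕ} (hK : 0 < K) (hc : c < 2 ^ K) (n i : ℕ) :
    slot K (repDigit K n c) i = if i < n then c else 0 := by
  have h1 : repDigit K n c
      = (∑ j ∈ Finset.range n, Polynomial.C c * Polynomial.X ^ j : Polynomial ℕ).eval (2 ^ K) := by
    simp only [Polynomial.eval_finsetSum, Polynomial.eval_mul, Polynomial.eval_C,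
      Polynomial.eval_pow, Polynomial.eval_X]
    rw [← Finset.mul_sum, Nat.geomSum_eq (Nat.pow_le_pow_right (by norm_num) hK : 2 ^ 1 ≤ 2 ^ K),
      repDigit, pow_mul, mul_comm]
  have h2 : ∀ j, (∑ j ∈ Finset.range n, Polynomial.C c * Polynomial.X ^ j : Polynomial ℕ).coeff j
      = if j < n then c else 0 := by
    intro j
    simp [Polynomial.coeff_X_pow]
  rw [h1, slot_eval _ fun j => by rw [h2]; split_ifs <;> omega, h2]

/-- Keep the `n` digits of `X` in base `2 ^ K` from place `r` on, each without its `t` lowest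
bits. -/
def truncateSlots (K t r n X : ℕ) : ℕ :=
  X / 2 ^ (K * r + t) &&& repDigit K n (2 ^ (K - t) - 1)

lemma slot_truncateSlots_le {K t : ℕ} (hK : 0 < K) (ht : t ≤ K) (r n X i : ℕ) :
    slot K (truncateSlots K t r n X) i ≤ slot K X (i + r) / 2 ^ t := by
  have hc : 2 ^ (K - t) - 1 < 2 ^ K :=
    lt_of_lt_of_le (Nat.sub_lt (by positivity) one_pos)
      (Nat.pow_le_pow_right (by norm_num) (Nat.sub_le _ _))
  rw [truncateSlots, slot_land, slot_repDigit hK hc]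
  split_ifs
  · rw [Nat.and_two_pow_sub_one_eq_mod, slot, slot,
      Nat.mod_mod_of_dvd _ (pow_dvd_pow 2 (Nat.sub_le K t)), Nat.div_div_eq_div_mul, ← pow_add]
    have h1 : 2 ^ K = 2 ^ t * 2 ^ (K - t) := by rw [← pow_add]; congr 1; omega
    rw [h1, Nat.mod_mul_right_div_self, Nat.div_div_eq_div_mul, ← pow_add]
    refine le_of_eq ?_
    congr 3
    ring
  · simp

lemma PackedBound.truncateSlots {K m o s X : ℕ} (h : PackedBound K m o s X) (hK : 0 < K) {t : ℕ}
    (ht : t ≤ K) (r n : ℕ) :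
    PackedBound K m (o + r) (s * 2 ^ t) (truncateSlots K t r n X) := by
  intro i
  calc s * 2 ^ t * slot K (_root_.truncateSlots K t r n X) i
      ≤ s * 2 ^ t * (slot K X (i + r) / 2 ^ t) := by
        gcongr
        exact slot_truncateSlots_le hK ht r n X i
    _ = s * (2 ^ t * (slot K X (i + r) / 2 ^ t)) := mul_assoc _ _ _
    _ ≤ s * slot K X (i + r) := by
        gcongr
        exact Nat.mul_div_le _ _
    _ ≤ _ := by
        rw [show i + (o + r) = i + r + o by ring]
        exact h _

/-- The number whose digits in base `2 ^ K` at the places `i < 2 ^ k` are `2 ^ K - 1` or `0`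
according to the value of `f (a + i)`. -/
def blockMask (K : ℕ) (f : ℕ → Bool) : ℕ → ℕ → ℕ
  | 0, a => bif f a then 2 ^ K - 1 else 0
  | k + 1, a => blockMask K f k a + (2 ^ K) ^ 2 ^ k * blockMask K f k (a + 2 ^ k)

lemma blockMask_eq_eval (K : ℕ) (f : ℕ → Bool) (k a : ℕ) :
    blockMask K f k a = (∑ i ∈ Finset.range (2 ^ k),
      Polynomial.C (bif f (a + i) then 2 ^ K - 1 else 0) * Polynomial.X ^ i).eval (2 ^ K) := by
  induction k generalizing a with
  | zero => simp [blockMask]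
  | succ k ih =>
    rw [blockMask, ih, ih, pow_succ, mul_two, Finset.sum_range_add, Polynomial.eval_add]
    congr 1
    simp only [Polynomial.eval_finsetSum, Polynomial.eval_mul, Polynomial.eval_C,
      Polynomial.eval_pow, Polynomial.eval_X, Finset.mul_sum]
    refine Finset.sum_congr rfl fun i _ => ?_
    rw [pow_add, add_assoc]
    ring

lemma slot_blockMask (K : ℕ) (f : ℕ → Bool) (k a i : ℕ) :
    slot K (blockMask K f k a) i
      = if i < 2 ^ k then (bif f (a + i) then 2 ^ K - 1 else 0) else 0 := by
  have hc : ∀ j, (∑ i ∈ Finset.range (2 ^ k), Polynomial.C (bif f (a + i) then 2 ^ K - 1 else 0)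
      * Polynomial.X ^ i : Polynomial ℕ).coeff j
      = if j < 2 ^ k then (bif f (a + j) then 2 ^ K - 1 else 0) else 0 := by
    intro j
    simp [Polynomial.coeff_X_pow]
  rw [blockMask_eq_eval, slot_eval, hc]
  intro j
  rw [hc]
  have : 0 < 2 ^ K := by positivity
  cases f (a + j) <;> split_ifs <;> simp

/-- The digits that the mask selects, summed up by casting out `2 ^ K - 1`, bound a density from
below. -/
lemma PackedBound.le_digitDensity {K m o s X : ℕ} (h : PackedBound K m o s X) (hK : 0 < K)
    {B : Set ℕ} {f : ℕ → Bool} {k : ℕ} (hf : ∀ i < 2 ^ k, f (o + i) = true → o + i ∈ B) {c : ℝ}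
    (hc : c * 10 ^ m ≤ ((s * ((X &&& blockMask K f k o) % (2 ^ K - 1)) : ℕ) : ℝ)) :
    c ≤ digitDensity B m := by
  obtain ⟨p, hp, hpc⟩ := exists_poly_coeff_eq_slot hK (X &&& blockMask K f k o)
  set I := (Finset.range (2 ^ k)).filter fun i => f (o + i) = true with hI
  have h0 : ∀ i ∉ I, p.coeff i = 0 := by
    intro i hi
    rw [hpc, slot_land, slot_blockMask]
    simp only [hI, Finset.mem_filter, Finset.mem_range, not_and, Bool.not_eq_true] at hi
    split_ifs with hik
    · simp [hi hik]
    · simp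
  have h1 : p.eval 1 = ∑ i ∈ I, p.coeff i := by
    rw [Polynomial.eval_eq_sum, Polynomial.sum_def]
    simp only [one_pow, mul_one]
    refine Finset.sum_subset (fun i hi => ?_) fun i _ hi => Polynomial.notMem_support_iff.1 hi
    by_contra hiI
    exact Polynomial.mem_support_iff.1 hi (h0 i hiI)
  have h2 : s * ∑ i ∈ I, p.coeff i ≤ ∑ j ∈ I.image (o + ·), (happyPoly m).coeff j := by
    rw [Finset.sum_image fun _ _ _ _ => Nat.add_left_cancel, Finset.mul_sum]
    refine Finset.sum_le_sum fun i _ => ?_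
    rw [hpc, slot_land, add_comm o]
    exact (Nat.mul_le_mul_left s Nat.and_le_left).trans (h i)
  have h3 := sum_happyPoly_coeff_le (B := B) (F := I.image (o + ·)) (by
    intro j hj
    obtain ⟨i, hi, rfl⟩ := Finset.mem_image.1 hj
    rw [hI, Finset.mem_filter, Finset.mem_range] at hi
    exact hf i hi.1 hi.2) m
  have h4 : s * ((X &&& blockMask K f k o) % (2 ^ K - 1)) ≤ s * ∑ i ∈ I, p.coeff i := by
    rw [← hp, ← h1]
    exact Nat.mul_le_mul_left s (mod_le_eval_one K p)
  have h5 : ((s * ((X &&& blockMask K f k o) % (2 ^ K - 1)) : ℕ) : ℝ)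
      ≤ ((∑ j ∈ I.image (o + ·), (happyPoly m).coeff j : ℕ) : ℝ) := by
    exact_mod_cast h4.trans h2
  have h6 : c * 10 ^ m ≤ digitDensity B m * 10 ^ m := by linarith
  exact le_of_mul_le_mul_right h6 (by positivity)

/-! ### Two densities computed -/

/-- The sum of the squares of the last `k` decimal digits. -/
def digitSqSum : ℕ → ℕ → ℕ
  | 0, _ => 0
  | k + 1, h => (h % 10) ^ 2 + digitSqSum k (h / 10)

lemma digitSqSum_eq (k : ℕ) {h : ℕ} (hh : h < 10 ^ k) : digitSqSum k h = happyMap 2 10 h := by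
  induction k generalizing h with
  | zero =>
    obtain rfl : h = 0 := by simpa using hh
    rw [happyMap_zero, digitSqSum]
  | succ k ih =>
    rw [pow_succ] at hh
    have := happyMap_ten_mul_add (h / 10) (h % 10) (Nat.mod_lt _ (by norm_num))
    rw [Nat.div_add_mod] at this
    rw [digitSqSum, ih (by omega), this, add_comm]

lemma digitSqSum_le (k h : ℕ) : digitSqSum k h ≤ 81 * k := by
  induction k generalizing h with
  | zero => rfl
  | succ k ih =>
    have h1 : (h % 10) ^ 2 ≤ 9 ^ 2 := Nat.pow_le_pow_left (by omega) 2
    have h2 := ih (h / 10)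
    rw [digitSqSum]
    omega

lemma isHappy_happyMap_iff (n : ℕ) : IsHappy 2 10 (happyMap 2 10 n) ↔ IsHappy 2 10 n := by
  have h0 : ∀ k, (happyMap 2 10)^[k] 0 = 0 := fun k => Function.iterate_fixed happyMap_zero k
  constructor
  · rintro ⟨h, k, hk⟩
    refine ⟨Nat.pos_of_ne_zero ?_, k + 1, hk⟩
    rintro rfl
    rw [happyMap_zero] at h
    exact lt_irrefl 0 h
  · rintro ⟨h, k, hk⟩
    have hk' : ∃ k, (happyMap 2 10)^[k] (happyMap 2 10 n) = 1 := by
      cases k with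
      | zero =>
        obtain rfl : n = 1 := hk
        exact ⟨0, by simp [happyMap]⟩
      | succ k => exact ⟨k, hk⟩
    refine ⟨Nat.pos_of_ne_zero fun h => ?_, hk'⟩
    obtain ⟨k, hk⟩ := hk'
    rw [h, h0] at hk
    exact zero_ne_one hk

lemma isHappy_iterate_digitSqSum_iff (k : ℕ) {s : ℕ} (hs : s < 1000) :
    IsHappy 2 10 ((digitSqSum 3)^[k] s) ↔ IsHappy 2 10 s := by
  induction k generalizing s with
  | zero => rfl
  | succ k ih =>
    rw [Function.iterate_succ_apply, ih ((digitSqSum_le 3 s).trans_lt (by norm_num)),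
      digitSqSum_eq 3 hs, isHappy_happyMap_iff]

/-- The fixed point `0` and the cycle of `4` of the happy function. -/
def unhappyCycle : Finset ℕ := {0, 4, 16, 37, 58, 89, 145, 42, 20}

lemma not_isHappy_of_mem_unhappyCycle {c : ℕ} (hc : c ∈ unhappyCycle) : ¬ IsHappy 2 10 c := by
  have step : ∀ c ∈ unhappyCycle, happyMap 2 10 c ∈ unhappyCycle := by
    intro c hc
    have h1 : ∀ c ∈ unhappyCycle, c < 10 ^ 3 ∧ digitSqSum 3 c ∈ unhappyCycle := by decide +kernel
    rw [← digitSqSum_eq 3 (h1 c hc).1]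
    exact (h1 c hc).2
  rintro ⟨-, k, hk⟩
  have h2 : (happyMap 2 10)^[k] c ∈ unhappyCycle := by
    clear hk
    induction k with
    | zero => exact hc
    | succ k ih =>
      rw [Function.iterate_succ_apply']
      exact step _ ih
  rw [hk] at h2
  exact absurd h2 (by decide)

/-- The numbers `s ≤ 405` that are happy, as a bit set. -/
def happyTable : ℕ :=
  41654088349772015274611054420895627802081990010947196252057269646700693645328374954589318644664588712640796767970289788034

/-- The numbers `s ≤ 405` that are not happy, as a bit set. -/
def unhappyTable : ℕ := 2 ^ 406 - 1 - happyTable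

/-- Whether the bit set `T` contains the happy function of a number below `10 ^ 5`. -/
def inTable (T h : ℕ) : Bool := Nat.beq (T / 2 ^ digitSqSum 5 h % 2) 1

lemma isHappy_of_inTable {h : ℕ} (hh : h < 10 ^ 5) (hT : inTable happyTable h = true) :
    IsHappy 2 10 h := by
  have key : ∀ s < 406, Nat.beq (happyTable / 2 ^ s % 2) 1 = true → (digitSqSum 3)^[8] s = 1 := by
    decide +kernel
  have hs : digitSqSum 5 h < 406 := (digitSqSum_le 5 h).trans_lt (by norm_num)
  rw [← isHappy_happyMap_iff, ← digitSqSum_eq 5 hh,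
    ← isHappy_iterate_digitSqSum_iff 8 (by omega), key _ hs hT]
  exact ⟨one_pos, 0, rfl⟩

lemma not_isHappy_of_inTable {h : ℕ} (hh : h < 10 ^ 5) (hT : inTable unhappyTable h = true) :
    ¬ IsHappy 2 10 h := by
  have key : ∀ s < 406, Nat.beq (unhappyTable / 2 ^ s % 2) 1 = true →
      (digitSqSum 3)^[12] s ∈ unhappyCycle := by
    decide +kernel
  have hs : digitSqSum 5 h < 406 := (digitSqSum_le 5 h).trans_lt (by norm_num)
  rw [← isHappy_happyMap_iff, ← digitSqSum_eq 5 hh,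
    ← isHappy_iterate_digitSqSum_iff 12 (by omega)]
  exact not_isHappy_of_mem_unhappyCycle (key _ hs hT)

/-- One round of the computation: cut the packed distribution down to a window of `n` places and to
fewer bits per place, then square it. -/
def squareWindow (K t r n X : ℕ) : ℕ := truncateSlots K t r n X ^ 2

lemma PackedBound.squareWindow {K m o s X : ℕ} (h : PackedBound K m o s X) (hK : 0 < K) {t : ℕ}
    (ht : t ≤ K) (r n : ℕ) (hs : 10 ^ (2 * m) < (s * 2 ^ t) ^ 2 * 2 ^ K) :
    PackedBound K (2 * m) (2 * (o + r)) ((s * 2 ^ t) ^ 2) (squareWindow K t r n X) :=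
  (h.truncateSlots hK ht r n).sq hK hs

/-- A packed lower bound for the distribution of the happy function of `404`-digit numbers, at the
places from `7418` on. The windows extend over at least six standard deviations on either side of
the mean. The digits have `336` bits because `10 ^ 101 < 2 ^ 336`, and half of these are dropped
before each squaring, so that the coefficients of the square fit again. In total this scales the
counts down by `2 ^ 1008`. -/
def packed404 : ℕ :=
  truncateSlots 336 0 1250 8192 (squareWindow 336 168 1108 5346 (squareWindow 336 168 988 3781
    ((∑ d ∈ Finset.range 10, (2 ^ 336) ^ d ^ 2) ^ 101)))

lemma packedBound_404 : PackedBound 336 404 7418 (2 ^ 1008) packed404 := by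
  have h0 := packedBound_pow (K := 336) (m := 101) (by decide +kernel)
  have h1 := h0.squareWindow (by norm_num) (t := 168) (by norm_num) 988 3781 (by decide +kernel)
  have h2 := h1.squareWindow (by norm_num) (t := 168) (by norm_num) 1108 5346 (by decide +kernel)
  have h3 := h2.truncateSlots (by norm_num) (t := 0) (by norm_num) 1250 8192
  have e : ((1 * 2 ^ 168) ^ 2 * 2 ^ 168) ^ 2 * 2 ^ 0 = 2 ^ 1008 := by decide +kernel
  rw [e] at h3
  exact h3

lemma happy_digitDensity_404 : 0.185773 ≤ digitDensity {n | IsHappy 2 10 n} 404 := by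
  refine packedBound_404.le_digitDensity (by norm_num) (f := inTable happyTable) (k := 13)
    (fun i hi h => isHappy_of_inTable (by omega) h) ?_
  have key : 185773 * 10 ^ 404 ≤ 10 ^ 6 * (2 ^ 1008 *
      ((packed404 &&& blockMask 336 (inTable happyTable) 13 7418) % (2 ^ 336 - 1))) := by
    decide +kernel
  generalize 2 ^ 1008 *
    ((packed404 &&& blockMask 336 (inTable happyTable) 13 7418) % (2 ^ 336 - 1)) = W at key ⊢
  have key' : (185773 * 10 ^ 404 : ℝ) ≤ 10 ^ 6 * W := by exact_mod_cast key
  rw [show (0.185773 : ℝ) = 185773 / 10 ^ 6 by norm_num, div_mul_eq_mul_div,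
    div_le_iff₀ (by positivity), mul_comm (W : ℝ)]
  exact key'

/-- A packed lower bound for the distribution of the happy function of `2368`-digit numbers, at the
places from `59296` on, obtained like `packed404` from `10 ^ 37 < 2 ^ 128` by six squarings. -/
def packed2368 : ℕ :=
  truncateSlots 128 0 4742 16384 (squareWindow 128 64 2679 12950 (squareWindow 128 64 1895 9150
    (squareWindow 128 64 1340 6470 (squareWindow 128 64 947 4600 (squareWindow 128 64 492 3300
      (squareWindow 128 59 0 2200 ((∑ d ∈ Finset.range 10, (2 ^ 128) ^ d ^ 2) ^ 37)))))))

lemma packedBound_2368 : PackedBound 128 2368 59296 (2 ^ 7744) packed2368 := by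
  have h0 := packedBound_pow (K := 128) (m := 37) (by decide +kernel)
  have h1 := h0.squareWindow (by norm_num) (t := 59) (by norm_num) 0 2200 (by decide +kernel)
  have h2 := h1.squareWindow (by norm_num) (t := 64) (by norm_num) 492 3300 (by decide +kernel)
  have h3 := h2.squareWindow (by norm_num) (t := 64) (by norm_num) 947 4600 (by decide +kernel)
  have h4 := h3.squareWindow (by norm_num) (t := 64) (by norm_num) 1340 6470 (by decide +kernel)
  have h5 := h4.squareWindow (by norm_num) (t := 64) (by norm_num) 1895 9150 (by decide +kernel)
  have h6 := h5.squareWindow (by norm_num) (t := 64) (by norm_num) 2679 12950 (by decide +kernel)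
  have h7 := h6.truncateSlots (by norm_num) (t := 0) (by norm_num) 4742 16384
  have e : ((((((1 * 2 ^ 59) ^ 2 * 2 ^ 64) ^ 2 * 2 ^ 64) ^ 2 * 2 ^ 64) ^ 2 * 2 ^ 64) ^ 2
      * 2 ^ 64) ^ 2 * 2 ^ 0 = 2 ^ 7744 := by decide +kernel
  rw [e] at h7
  exact h7

lemma unhappy_digitDensity_2368 : 0.886239 ≤ digitDensity {n | IsHappy 2 10 n}ᶜ 2368 := by
  refine packedBound_2368.le_digitDensity (by norm_num) (f := inTable unhappyTable) (k := 14)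
    (fun i hi h => not_isHappy_of_inTable (by omega) h) ?_
  have key : 886239 * 10 ^ 2368 ≤ 10 ^ 6 * (2 ^ 7744 *
      ((packed2368 &&& blockMask 128 (inTable unhappyTable) 14 59296) % (2 ^ 128 - 1))) := by
    decide +kernel
  generalize 2 ^ 7744 *
    ((packed2368 &&& blockMask 128 (inTable unhappyTable) 14 59296) % (2 ^ 128 - 1)) = W at key ⊢
  have key' : (886239 * 10 ^ 2368 : ℝ) ≤ 10 ^ 6 * W := by exact_mod_cast key
  rw [show (0.886239 : ℝ) = 886239 / 10 ^ 6 by norm_num, div_mul_eq_mul_div,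
    div_le_iff₀ (by positivity), mul_comm (W : ℝ)]
  exact key'

/-! ### Upper and lower density -/

lemma digitDensity_compl (B : Set ℕ) (m : ℕ) : digitDensity Bᶜ m = 1 - digitDensity B m := by
  have h := happyMean_add m (B.indicator fun _ => 1) (Bᶜ.indicator fun _ => 1)
  have e : (fun x => B.indicator (fun _ => (1 : ℝ)) x + Bᶜ.indicator (fun _ => 1) x)
      = fun _ => 1 := by
    ext x
    exact congrFun (Set.indicator_self_add_compl B fun _ => (1 : ℝ)) x
  rw [e, happyMean_const] at h
  simp only [digitDensity]
  linarith

lemma relDensity_mem_Icc (A : Set ℕ) (n : ℕ) : 0 ≤ relDensity A n ∧ relDensity A n ≤ 1 := by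
  refine ⟨by unfold relDensity; positivity, div_le_one_of_le₀ ?_ (by positivity)⟩
  have h := Set.ncard_le_ncard (Set.inter_subset_right (s := A) (t := Set.Icc 1 n))
    (Set.finite_Icc 1 n)
  rw [← Finset.coe_Icc, Set.ncard_coe_finset, Nat.card_Icc, Nat.add_sub_cancel] at h
  rw [← Finset.coe_Icc]
  exact_mod_cast h

lemma relDensity_pow_sub_one {A : Set ℕ} (h0 : 0 ∉ A) (hA : ∀ n, happyMap 2 10 n ∈ A ↔ n ∈ A)
    (m : ℕ) : relDensity A (10 ^ m - 1) = 10 ^ m * digitDensity A m / (10 ^ m - 1) := by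
  classical
  have hset : A ∩ Set.Icc 1 (10 ^ m - 1) = ((Finset.range (10 ^ m)).filter (· ∈ A) : Finset ℕ) := by
    ext n
    have : 0 < 10 ^ m := by positivity
    simp only [Set.mem_inter_iff, Set.mem_Icc, Finset.coe_filter, Finset.mem_range,
      Set.mem_ofPred_eq]
    constructor
    · rintro ⟨h1, h2, h3⟩
      exact ⟨by omega, h1⟩
    · rintro ⟨h1, h2⟩
      have : n ≠ 0 := by
        rintro rfl
        exact h0 h2
      exact ⟨h2, by omega, by omega⟩
  rw [relDensity, hset, Set.ncard_coe_finset, ← sum_indicator_eq hA, Finset.card_filter,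
    Nat.cast_sub (Nat.one_le_pow _ _ (by norm_num))]
  simp [Set.indicator_apply]

lemma tendsto_ten_pow_sub_one : Tendsto (fun m : ℕ => 10 ^ m - 1) atTop atTop :=
  tendsto_atTop_mono (fun m => Nat.le_sub_one_of_lt (Nat.lt_pow_self (by norm_num))) tendsto_id

lemma isBoundedUnder_le_relDensity (A : Set ℕ) :
    IsBoundedUnder (· ≤ ·) atTop (relDensity A) :=
  isBoundedUnder_of ⟨1, fun n => (relDensity_mem_Icc A n).2⟩

lemma isBoundedUnder_ge_relDensity (A : Set ℕ) :
    IsBoundedUnder (· ≥ ·) atTop (relDensity A) :=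
  isBoundedUnder_of ⟨0, fun n => (relDensity_mem_Icc A n).1⟩

lemma error_term_le {k : ℕ} (hk : 400 ≤ k) : (200 : ℝ) / 10 ^ (k / 8) ≤ 1 / 10 ^ 6 := by
  have h1 : (10 : ℝ) ^ 50 ≤ 10 ^ (k / 8) := pow_le_pow_right₀ (by norm_num) (by omega)
  calc (200 : ℝ) / 10 ^ (k / 8) ≤ 200 / 10 ^ 50 := by gcongr
    _ ≤ _ := by norm_num

lemma lowerDensity_happy_lt : lowerDensity {n : ℕ | IsHappy 2 10 n} < 0.1138 := by
  set A := {n : ℕ | IsHappy 2 10 n} with hA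
  have hinv : ∀ n, happyMap 2 10 n ∈ A ↔ n ∈ A := isHappy_happyMap_iff
  have h0 : 0 ∉ A := fun h => lt_irrefl 0 h.1
  have h1 : ∃ᶠ m in atTop, digitDensity A m ≤ 0.11377 := by
    refine frequently_digitDensity_le hinv (k := 2368) (by norm_num)
      ((add_le_add_right (error_term_le (by norm_num)) _).trans ?_)
    have h2 := unhappy_digitDensity_2368
    rw [digitDensity_compl, ← hA] at h2
    norm_num at h2 ⊢
    linarith
  have h2 : ∃ᶠ m in atTop, relDensity A (10 ^ m - 1) ≤ 0.11379 := by
    refine (h1.and_eventually (eventually_ge_atTop 6)).mono ?_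
    rintro m ⟨hm, hm6⟩
    have h3 : (10 : ℝ) ^ 6 ≤ 10 ^ m := pow_le_pow_right₀ (by norm_num) hm6
    rw [relDensity_pow_sub_one h0 hinv, div_le_iff₀ (by linarith)]
    have h4 : (10 : ℝ) ^ m * digitDensity A m ≤ 10 ^ m * 0.11377 := by gcongr
    linarith
  calc lowerDensity A ≤ 0.11379 :=
        liminf_le_of_frequently_le (tendsto_ten_pow_sub_one.frequently h2)
          (isBoundedUnder_ge_relDensity A)
    _ < 0.1138 := by norm_num

lemma lt_upperDensity_happy : 0.18577 < upperDensity {n : ℕ | IsHappy 2 10 n} := by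
  set A := {n : ℕ | IsHappy 2 10 n} with hA
  have hinv : ∀ n, happyMap 2 10 n ∈ A ↔ n ∈ A := isHappy_happyMap_iff
  have h0 : 0 ∉ A := fun h => lt_irrefl 0 h.1
  have h1 : ∃ᶠ m in atTop, digitDensity Aᶜ m ≤ 1 - 0.185772 := by
    refine frequently_digitDensity_le (fun n => not_congr (hinv n)) (k := 404) (by norm_num)
      ((add_le_add_right (error_term_le (by norm_num)) _).trans ?_)
    have h2 := happy_digitDensity_404
    rw [digitDensity_compl]
    rw [← hA] at h2
    norm_num at h2 ⊢
    linarith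
  have h2 : ∃ᶠ m in atTop, 0.185772 ≤ relDensity A (10 ^ m - 1) := by
    refine (h1.and_eventually (eventually_ge_atTop 1)).mono ?_
    rintro m ⟨hm, hm1⟩
    have h3 : (10 : ℝ) ^ 1 ≤ 10 ^ m := pow_le_pow_right₀ (by norm_num) hm1
    rw [digitDensity_compl] at hm
    rw [relDensity_pow_sub_one h0 hinv, le_div_iff₀ (by linarith)]
    have h4 : (10 : ℝ) ^ m * 0.185772 ≤ 10 ^ m * digitDensity A m := by
      gcongr
      linarith
    linarith
  calc (0.18577 : ℝ) < 0.185772 := by norm_num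
    _ ≤ upperDensity A :=
        le_limsup_of_frequently_le (tendsto_ten_pow_sub_one.frequently h2)
          (isBoundedUnder_le_relDensity A)

theorem mainTheorem2 :
    lowerDensity {n : ℕ | IsHappy 2 10 n} < 0.1138 ∧
      0.18577 < upperDensity {n : ℕ | IsHappy 2 10 n} ∧
      ¬ ∃ d : ℝ, HasAsymptoticDensity {n : ℕ | IsHappy 2 10 n} d := by
  refine ⟨lowerDensity_happy_lt, lt_upperDensity_happy, ?_⟩
  rintro ⟨d, hd⟩
  have hl := lowerDensity_happy_lt
  have hu := lt_upperDensity_happy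
  rw [lowerDensity, hd.liminf_eq] at hl
  rw [upperDensity, hd.limsup_eq] at hu
  norm_num at hl hu
  linarith
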